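/- Define the B-splines by $Q_1=\chi_{[0,1)}$, $Q_{m+1}(t)=\int_{\mathbb R}Q_m(t-y)Q_1(y)\,dy$. For $\kappa=(Q_4,0,3)$ let $\Psi_\kappa(t)$ be the $3\times 3$ matrix with entries $\Psi_\kappa^{ij}(t)=\sum_{k\in\mathbb Z}Q_4^{(i)}(3k-j)e^{2\pi \mathrm{i}kt}$, $0\le i,j\le 2$. Put $$\Theta_{i,\kappa}(t)=\sum_{v\in\mathbb Z}\sum_{j=0}^{2}\widehat{(\Psi_\kappa^{-1})^{ji}}(v)\,Q_4(t-3v-j),\qquad \widehat g(v)=\int_0^1 g(t)e^{-2\pi \mathrm{i}vt}\,dt,$$ and, for $W\ge 1$, $$(S_W^\kappa f)(t)=\sum_{l\in\mathbb Z}\sum_{i=0}^{2}\frac1{W^i}f^{(i)}\Big(\frac{3l}{W}\Big)\Theta_{i,\kappa}(Wt-3l).$$ For $r\in\mathbb N$, $\delta>0$, $1\le p<\infty$ let $(\Delta_h^rg)(t)=\sum_{j=0}^r(-1)^{r-j}\binom rj g(t+jh)$, $$\omega_r(g;x;\delta)=\sup\{|(\Delta_h^rg)(t)|: t,\,t+rh\in[x-\tfrac{r\delta}2,x+\tfrac{r\delta}2]\}\in[0,\infty],\qquad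 \tau_r(g,\delta)_p=\|\omega_r(g;\cdot;\delta)\|_{L^p(\mathbb R)}\in[0,\infty].$$ A sequence $(x_j)_{j\in\mathbb Z}$ of reals is admissible if $0<\inf_j(x_j-x_{j-1})\le\sup_j(x_j-x_{j-1})<\infty$. Let $\Lambda_3^p$ be the set of bounded measurable, everywhere twice differentiable functions $f:\mathbb R\to\mathbb C$ such that $\sum_{j\in\mathbb Z}\sum_{i=0}^{2}|f^{(i)}(x_j)|^p(x_j-x_{j-1})<\infty$ for every admissible sequence $(x_j)$. Then $\Psi_\kappa(t)$ is invertible for all $t\in\mathbb R$, the series defining $(S_W^\kappa f)(t)$ converges for all $f:\mathbb R\to\mathbb C$ having the derivatives it involves, all $W\ge1$ and all $t\in\mathbb R$, and: 1. $S_W^\kappa$ reproduces polynomials of degree at most $3$: $S_W^\kappa P=P$ on $\mathbb R$ for every polynomial $P$ of degree $\le 3$ and every $W\ge1$. 2. Let $1\le p<\infty$ and $\alpha>0$. If $f\in\Lambda_3^p$ and $\tau_3(f^{(i)},\delta)_p=\mathcal O(\delta^\alpha)$ as $\delta\to0+$ for $i=0,1,2$, then $S_W^\kappa f-f\in L^p(\mathbb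 R)$ for all sufficiently large $W$ and $$\|S_W^\kappa f-f\|_{L^p(\mathbb R)}=\mathcal O(W^{-\alpha})\qquad(W\to\infty).$$ -/

import Mathlib

open MeasureTheory Filter
open scoped ENNReal NNReal

namespace DerivSampling

noncomputable section

/-- The B-splines: `Q₁` is the indicator function of `[0,1)` and
`Q_{m+1}(t) = ∫ Q_m(t - y) Q₁(y) dy` for `m ≥ 1`. The value at index `0` is a dummy. -/
def bspline : ℕ → ℝ → ℝ
  | 0 => fun _ => 0
  | 1 => Set.indicator (Set.Ico (0 : ℝ) 1) (fun _ => 1)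
  | m + 2 => fun t => ∫ y : ℝ, bspline (m + 1) (t - y) *
      Set.indicator (Set.Ico (0 : ℝ) 1) (fun _ => (1 : ℝ)) y

/-- The matrix symbol `Ψ_κ(t)` of `κ = (φ, a, ρ)`, with entries
`Ψ^{ij}(t) = ∑_{k ∈ ℤ} φ^{(i)}(a + ρ k - j) e^{2π i k t}`, `0 ≤ i, j ≤ ρ - 1`. -/
def Psi (φ : ℝ → ℝ) (a : ℝ) (ρ : ℕ) (t : ℝ) : Matrix (Fin ρ) (Fin ρ) ℂ :=
  Matrix.of fun i j => ∑' k : ℤ,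
    ((iteratedDeriv (i : ℕ) φ (a + (ρ : ℝ) * (k : ℝ) - ((j : ℕ) : ℝ)) : ℝ) : ℂ) *
      Complex.exp (2 * (Real.pi : ℂ) * Complex.I * (k : ℂ) * (t : ℂ))

/-- The `v`-th Fourier coefficient `∫₀¹ (Ψ_κ⁻¹)^{ji}(t) e^{-2π i v t} dt` of the `(j,i)` entry of
the inverse matrix. -/
def psiInvCoeff (φ : ℝ → ℝ) (a : ℝ) (ρ : ℕ) (j i : Fin ρ) (v : ℤ) : ℂ :=
  ∫ t in (0 : ℝ)..1, (Psi φ a ρ t)⁻¹ j i *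
    Complex.exp (-(2 * (Real.pi : ℂ) * Complex.I * (v : ℂ) * (t : ℂ)))

/-- The reconstruction functions
`Θ_{i,κ}(t) = ∑_{v ∈ ℤ} ∑_{j < ρ} (Ψ_κ⁻¹)^{ji}^(v) φ(t - ρ v - j)`. -/
def Theta (φ : ℝ → ℝ) (a : ℝ) (ρ : ℕ) (i : Fin ρ) (t : ℝ) : ℂ :=
  ∑' v : ℤ, ∑ j : Fin ρ, psiInvCoeff φ a ρ j i v *
    ((φ (t - (ρ : ℝ) * (v : ℝ) - ((j : ℕ) : ℝ)) : ℝ) : ℂ)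

/-- The `l`-th term `∑_{i < ρ} W^{-i} f^{(i)}((a + ρ l)/W) Θ_{i,κ}(W t - ρ l)` of the derivative
sampling series. -/
def samplingTerm (φ : ℝ → ℝ) (a : ℝ) (ρ : ℕ) (W : ℝ) (f : ℝ → ℂ) (t : ℝ) (l : ℤ) : ℂ :=
  ∑ i : Fin ρ, (1 / (W : ℂ) ^ (i : ℕ)) *
    iteratedDeriv (i : ℕ) f ((a + (ρ : ℝ) * (l : ℝ)) / W) *
      Theta φ a ρ i (W * t - (ρ : ℝ) * (l : ℝ))

/-- The derivative sampling operator `S_W^κ`, `κ = (φ, a, ρ)`. -/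
def samplingOp (φ : ℝ → ℝ) (a : ℝ) (ρ : ℕ) (W : ℝ) (f : ℝ → ℂ) (t : ℝ) : ℂ :=
  ∑' l : ℤ, samplingTerm φ a ρ W f t l

/-- `S_W^κ` reproduces polynomials of degree at most `r`, for every `W ≥ 1`. -/
def ReproducesPolynomials (φ : ℝ → ℝ) (a : ℝ) (ρ r : ℕ) : Prop :=
  ∀ P : Polynomial ℂ, P.natDegree ≤ r → ∀ W : ℝ, 1 ≤ W → ∀ t : ℝ,
    samplingOp φ a ρ W (fun x : ℝ => P.eval (x : ℂ)) t = P.eval (t : ℂ)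

/-- The forward difference `(Δ_h^r f)(t) = ∑_{j=0}^r (-1)^{r-j} (r choose j) f(t + j h)`. -/
def fdiff (r : ℕ) (h : ℝ) (f : ℝ → ℂ) (t : ℝ) : ℂ :=
  ∑ j ∈ Finset.range (r + 1), (-1 : ℂ) ^ (r - j) * (r.choose j : ℂ) * f (t + (j : ℝ) * h)

/-- The local modulus of smoothness
`ω_r(f; x; δ) = sup {|(Δ_h^r f)(t)| : t, t + r h ∈ [x - rδ/2, x + rδ/2]}`, as an extended
nonnegative real (so it is `∞` if the supremum is infinite). -/
def localModulus (r : ℕ) (f : ℝ → ℂ) (x δ : ℝ) : ℝ≥0∞ :=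
  ⨆ (t : ℝ) (h : ℝ)
    (_ : t ∈ Set.Icc (x - r * δ / 2) (x + r * δ / 2))
    (_ : t + r * h ∈ Set.Icc (x - r * δ / 2) (x + r * δ / 2)), ‖fdiff r h f t‖ₑ

/-- The averaged modulus of smoothness `τ_r(f; δ)_p = ‖ω_r(f; ·; δ)‖_{L^p(ℝ)}`, in `[0, ∞]`. -/
def tauModulus (r : ℕ) (f : ℝ → ℂ) (δ p : ℝ) : ℝ≥0∞ :=
  (∫⁻ x : ℝ, localModulus r f x δ ^ p) ^ (1 / p)

/-- Admissible partitions `(x_j)_{j ∈ ℤ}` of the real line: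
`0 < inf_j (x_j - x_{j-1}) ≤ sup_j (x_j - x_{j-1}) < ∞`. -/
def IsAdmissible (x : ℤ → ℝ) : Prop :=
  (∃ c : ℝ, 0 < c ∧ ∀ j : ℤ, c ≤ x j - x (j - 1)) ∧
    ∃ C : ℝ, ∀ j : ℤ, x j - x (j - 1) ≤ C

/-- The discrete norm
`(∑_{j ∈ ℤ} ∑_{i < ρ} |f^{(i)}(x_j)|^p (x_j - x_{j-1}))^{1/p}`, in `[0, ∞]`. -/
def discreteNorm (ρ : ℕ) (p : ℝ) (x : ℤ → ℝ) (f : ℝ → ℂ) : ℝ≥0∞ :=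
  (∑' j : ℤ, ∑ i ∈ Finset.range ρ,
    ‖iteratedDeriv i f (x j)‖ₑ ^ p * ENNReal.ofReal (x j - x (j - 1))) ^ (1 / p)

/-- The space `Λ_ρ^p`: bounded (Lebesgue) measurable functions with finite discrete norm for every
admissible partition. The norm requires `f` to be `(ρ-1)`-times differentiable at the points of the
partition; as every real number lies in some admissible partition, this means that `f` is
`(ρ-1)`-times differentiable everywhere. -/
structure MemLambda (ρ : ℕ) (p : ℝ) (f : ℝ → ℂ) : Prop where
  measurable : AEStronglyMeasurable f volume
  bounded : ∃ M : ℝ, ∀ x : ℝ, ‖f x‖ ≤ M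
  differentiable : ∀ i : ℕ, i < ρ - 1 → Differentiable ℝ (iteratedDeriv i f)
  finite_norm : ∀ x : ℤ → ℝ, IsAdmissible x → discreteNorm ρ p x f < ∞

end

end DerivSampling

namespace DerivSampling

/-! The cubic B-spline `Q₄` and its first two derivatives vanish outside `(0,4)`, so in each entry
of the symbol only the shift `k = 1` survives. The symbol is therefore `e^{2πit}` times a constant
invertible matrix, and its inverse has a single nonzero Fourier coefficient, at `v = -1`. Each
reconstruction function is then a combination of three shifted B-splines and vanishes outside
`(-3,3)`. On a cell between consecutive nodes the operator uses only the Hermite data at the two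
endpoints (`hasSum_samplingTerm`), and four spline identities on `[0,3]` give cubic reproduction
(`Theta_bspline_four_identities`).

For the rate, reproduction of quadratics lets the Taylor polynomial of `f` at the left node be split
off, leaving Taylor remainders at the right node times bounded functions
(`samplingOp_eq_taylor_add`). After rescaling the cell to `[0,3]`, these remainders are bounded by
the oscillation of the second derivative.

No third derivative is available, so this oscillation is compared with third differences
(`norm_second_deriv_sub_le`). A derivative differs from a four-point difference quotient by at most
a third difference of that derivative. Using this twice replaces `f''` by second differences of `f`,
whose increments are mixed third differences, hence combinations of pure ones. The resulting bound
by local moduli is integrated to give averaged moduli at scale `6/W`. -/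

/-! ### Truncated powers and the closed form of the cubic B-spline. -/

/-- The truncated power `x ↦ x₊ⁿ`. -/
def truncPow (n : ℕ) (x : ℝ) : ℝ := max x 0 ^ n

lemma truncPow_of_nonpos {n : ℕ} (hn : n ≠ 0) {x : ℝ} (hx : x ≤ 0) : truncPow n x = 0 := by
  simp [truncPow, max_eq_right hx, hn]

lemma truncPow_of_nonneg (n : ℕ) {x : ℝ} (hx : 0 ≤ x) : truncPow n x = x ^ n := by
  simp [truncPow, max_eq_left hx]

@[fun_prop]
lemma continuous_truncPow (n : ℕ) : Continuous (truncPow n) := by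
  unfold truncPow; fun_prop

lemma hasDerivAt_truncPow (n : ℕ) (hn : n ≠ 0) (x : ℝ) :
    HasDerivAt (truncPow (n + 1)) ((n + 1) * truncPow n x) x := by
  have key : ∀ y : ℝ, y ≠ 0 → HasDerivAt (truncPow (n + 1)) ((n + 1) * truncPow n y) y := by
    intro y hy
    rcases lt_or_gt_of_ne hy with h | h
    · rw [truncPow_of_nonpos hn h.le, mul_zero]
      refine (hasDerivAt_const y (0 : ℝ)).congr_of_eventuallyEq ?_
      filter_upwards [Iio_mem_nhds h] with z hz
      exact truncPow_of_nonpos (Nat.succ_ne_zero n) (le_of_lt hz)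
    · rw [truncPow_of_nonneg n h.le]
      refine HasDerivAt.congr_of_eventuallyEq (f := fun z : ℝ => z ^ (n + 1)) ?_ ?_
      · simpa using hasDerivAt_pow (n + 1) y
      · filter_upwards [Ioi_mem_nhds h] with z hz
        exact truncPow_of_nonneg _ (le_of_lt hz)
  by_cases hx : x = 0
  · subst hx
    -- At the knot, differentiability follows from the continuous extension of the derivative off
    -- it.
    exact hasDerivAt_of_hasDerivAt_of_ne (g := fun y => (n + 1) * truncPow n y) key
      (continuous_truncPow _).continuousAt (by fun_prop)
  · exact key x hx

lemma hasDerivAt_truncPow_sub (n : ℕ) (hn : n ≠ 0) (a x : ℝ) :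
    HasDerivAt (fun y => truncPow (n + 1) (y - a)) ((n + 1) * truncPow n (x - a)) x := by
  exact (hasDerivAt_truncPow n hn (x - a)).comp_sub_const x a

lemma hasDerivWithinAt_truncPow_one (x : ℝ) :
    HasDerivWithinAt (truncPow 1) (if 0 ≤ x then 1 else 0) (Set.Ioi x) x := by
  split_ifs with h
  · refine (hasDerivWithinAt_id x (Set.Ioi x)).congr (fun y hy => ?_) ?_
    · simp [truncPow_of_nonneg 1 (h.trans (le_of_lt hy))]
    · simp [truncPow_of_nonneg 1 h]
  · push Not at h
    refine ((hasDerivAt_const x (0 : ℝ)).congr_of_eventuallyEq ?_).hasDerivWithinAt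
    filter_upwards [Iio_mem_nhds h] with z hz
    exact truncPow_of_nonpos one_ne_zero (le_of_lt hz)

lemma bspline_succ_succ (m : ℕ) (t : ℝ) :
    bspline (m + 2) t = ∫ y in (t - 1)..t, bspline (m + 1) y := by
  have h1 : bspline (m + 2) t = ∫ y : ℝ, bspline (m + 1) (t - y) *
      Set.indicator (Set.Ico (0 : ℝ) 1) (fun _ => (1 : ℝ)) y := rfl
  have h2 : (fun y : ℝ => bspline (m + 1) (t - y) *
      Set.indicator (Set.Ico (0 : ℝ) 1) (fun _ => (1 : ℝ)) y) =
      Set.indicator (Set.Ico (0 : ℝ) 1) (fun y => bspline (m + 1) (t - y)) := by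
    ext y; by_cases hy : y ∈ Set.Ico (0 : ℝ) 1 <;> simp [hy]
  rw [h1, h2, integral_indicator measurableSet_Ico, integral_Ico_eq_integral_Ioo,
    ← integral_Ioc_eq_integral_Ioo, ← intervalIntegral.integral_of_le zero_le_one,
    intervalIntegral.integral_comp_sub_left (fun y => bspline (m + 1) y) t]
  simp

/-- `Q₁` jumps, so its primitive has kinks; the fundamental theorem of calculus is applied with
right derivatives, which match the half-open convention of `[0,1)`. -/
lemma bspline_two (t : ℝ) :
    bspline 2 t = truncPow 1 t - 2 * truncPow 1 (t - 1) + truncPow 1 (t - 2) := by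
  have h1 : ∀ x : ℝ, bspline 1 x =
      (if 0 ≤ x then (1 : ℝ) else 0) - (if 0 ≤ x - 1 then (1 : ℝ) else 0) := by
    intro x
    simp only [bspline, Set.indicator_apply, Set.mem_Ico]
    split_ifs <;> grind
  have h2 : IntervalIntegrable (bspline 1) volume (t - 1) t := by
    have : Integrable (bspline 1) volume := by
      simp only [bspline]
      rw [integrable_indicator_iff measurableSet_Ico]
      simp
    exact this.intervalIntegrable
  rw [bspline_succ_succ, intervalIntegral.integral_eq_sub_of_hasDeriv_right
    (f := fun x => truncPow 1 x - truncPow 1 (x - 1)) (by fun_prop) ?_ h2]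
  · rw [show t - 1 - 1 = t - 2 by ring]; ring
  · intro x _
    rw [h1]
    refine (hasDerivWithinAt_truncPow_one x).sub ?_
    have := (hasDerivWithinAt_truncPow_one (x - 1)).comp x
      ((hasDerivWithinAt_id x (Set.Ioi x)).sub_const 1) (fun y hy => by simpa using hy)
    simpa [Function.comp_def] using this

lemma bspline_three (t : ℝ) :
    bspline 3 t = (truncPow 2 t - 3 * truncPow 2 (t - 1) + 3 * truncPow 2 (t - 2) -
      truncPow 2 (t - 3)) / 2 := by
  have h0 : bspline 2 = fun t => truncPow 1 t - 2 * truncPow 1 (t - 1) + truncPow 1 (t - 2) :=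
    funext bspline_two
  rw [bspline_succ_succ, h0, intervalIntegral.integral_eq_sub_of_hasDerivAt
    (f := fun x => (truncPow 2 x - 2 * truncPow 2 (x - 1) + truncPow 2 (x - 2)) / 2) ?_
    (Continuous.intervalIntegrable (by fun_prop) _ _)]
  · rw [show t - 1 - 1 = t - 2 by ring, show t - 1 - 2 = t - 3 by ring]; ring
  · intro x _
    have := ((((hasDerivAt_truncPow 1 one_ne_zero x).sub
      ((hasDerivAt_truncPow_sub 1 one_ne_zero 1 x).const_mul 2)).add
      (hasDerivAt_truncPow_sub 1 one_ne_zero 2 x)).div_const 2)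
    refine this.congr_deriv ?_
    push_cast; ring

/-- The fourth difference of `truncPow n`. -/
def splineSum (n : ℕ) (x : ℝ) : ℝ :=
  truncPow n x - 4 * truncPow n (x - 1) + 6 * truncPow n (x - 2) - 4 * truncPow n (x - 3) +
    truncPow n (x - 4)

@[fun_prop]
lemma continuous_splineSum (n : ℕ) : Continuous (splineSum n) := by
  unfold splineSum; fun_prop

lemma hasDerivAt_splineSum (n : ℕ) (hn : n ≠ 0) (x : ℝ) :
    HasDerivAt (splineSum (n + 1)) ((n + 1) * splineSum n x) x := by
  have := ((((hasDerivAt_truncPow n hn x).sub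
    ((hasDerivAt_truncPow_sub n hn 1 x).const_mul 4)).add
    ((hasDerivAt_truncPow_sub n hn 2 x).const_mul 6)).sub
    ((hasDerivAt_truncPow_sub n hn 3 x).const_mul 4)).add
    (hasDerivAt_truncPow_sub n hn 4 x)
  refine this.congr_deriv ?_
  simp only [splineSum]; ring

lemma bspline_four : bspline 4 = fun t => splineSum 3 t / 6 := by
  ext t
  have h0 : bspline 3 = fun t => (truncPow 2 t - 3 * truncPow 2 (t - 1) + 3 * truncPow 2 (t - 2) -
      truncPow 2 (t - 3)) / 2 := funext bspline_three
  rw [bspline_succ_succ, h0, intervalIntegral.integral_eq_sub_of_hasDerivAt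
    (f := fun x => (truncPow 3 x - 3 * truncPow 3 (x - 1) + 3 * truncPow 3 (x - 2) -
      truncPow 3 (x - 3)) / 6) ?_ (Continuous.intervalIntegrable (by fun_prop) _ _)]
  · rw [show t - 1 - 1 = t - 2 by ring, show t - 1 - 2 = t - 3 by ring,
      show t - 1 - 3 = t - 4 by ring]
    simp only [splineSum]; ring
  · intro x _
    have := ((((hasDerivAt_truncPow 2 two_ne_zero x).sub
      ((hasDerivAt_truncPow_sub 2 two_ne_zero 1 x).const_mul 3)).add
      ((hasDerivAt_truncPow_sub 2 two_ne_zero 2 x).const_mul 3)).sub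
      (hasDerivAt_truncPow_sub 2 two_ne_zero 3 x)).div_const 6
    refine this.congr_deriv ?_
    push_cast; ring

lemma iteratedDeriv_one_bspline_four :
    iteratedDeriv 1 (bspline 4) = fun t => splineSum 2 t / 2 := by
  rw [iteratedDeriv_one, bspline_four]
  ext t
  rw [((hasDerivAt_splineSum 2 two_ne_zero t).div_const 6).deriv]
  push_cast; ring

lemma iteratedDeriv_two_bspline_four : iteratedDeriv 2 (bspline 4) = splineSum 1 := by
  rw [iteratedDeriv_succ, iteratedDeriv_one_bspline_four]
  ext t
  rw [((hasDerivAt_splineSum 1 one_ne_zero t).div_const 2).deriv]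
  push_cast; ring

lemma splineSum_of_nonpos {n : ℕ} (hn : n ≠ 0) {x : ℝ} (hx : x ≤ 0) : splineSum n x = 0 := by
  simp only [splineSum]
  rw [truncPow_of_nonpos hn hx, truncPow_of_nonpos hn (by linarith),
    truncPow_of_nonpos hn (by linarith), truncPow_of_nonpos hn (by linarith),
    truncPow_of_nonpos hn (by linarith)]
  ring

/-- Beyond the last knot every truncated power is a genuine power, and a fourth difference
annihilates polynomials of degree below four. -/
lemma splineSum_of_four_le {n : ℕ} (hn : n < 4) {x : ℝ} (hx : 4 ≤ x) : splineSum n x = 0 := by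
  simp only [splineSum]
  rw [truncPow_of_nonneg n (by linarith), truncPow_of_nonneg n (by linarith),
    truncPow_of_nonneg n (by linarith), truncPow_of_nonneg n (by linarith),
    truncPow_of_nonneg n (by linarith)]
  interval_cases n <;> ring

/-! ### The symbol and its inverse. -/

/-- Hermite data of the three cubic B-splines that meet at an interpolation node. -/
noncomputable def nodeMatrix : Matrix (Fin 3) (Fin 3) ℂ := !![1/6, 2/3, 1/6; -1/2, 0, 1/2; 1, -2, 1]

/-- The inverse of `nodeMatrix`. -/
noncomputable def nodeMatrixInv : Matrix (Fin 3) (Fin 3) ℂ := !![1, -1, 1/3; 1, 0, -1/6; 1, 1, 1/3]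

lemma nodeMatrix_mul_nodeMatrixInv : nodeMatrix * nodeMatrixInv = 1 := by
  ext i j
  fin_cases i <;> fin_cases j <;>
    simp [nodeMatrix, nodeMatrixInv, Matrix.mul_apply, Fin.sum_univ_three] <;> norm_num

/-- The endpoints `0` and `4` must be included: they occur as `3k - j` for `k = j = 0` and for `k =
j = 2`. -/
lemma iteratedDeriv_bspline_four_eq_zero (i : Fin 3) {x : ℝ} (hx : x ≤ 0 ∨ 4 ≤ x) :
    iteratedDeriv (i : ℕ) (bspline 4) x = 0 := by
  have h : ∀ n : ℕ, n ≠ 0 → n < 4 → splineSum n x = 0 := fun n h0 h4 =>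
    hx.elim (splineSum_of_nonpos h0) (splineSum_of_four_le h4)
  fin_cases i
  · simp [bspline_four, h 3]
  · exact (congrFun iteratedDeriv_one_bspline_four x).trans (by simp [h 2])
  · exact (congrFun iteratedDeriv_two_bspline_four x).trans (by simp [h 1])

lemma iteratedDeriv_bspline_four_node (i j : Fin 3) :
    ((iteratedDeriv (i : ℕ) (bspline 4) (3 - ((j : ℕ) : ℝ)) : ℝ) : ℂ) = nodeMatrix i j := by
  have h0 : ∀ n : ℕ, truncPow n 0 = 0 ^ n := fun n => truncPow_of_nonneg n le_rfl
  have h1 : ∀ n : ℕ, truncPow n 1 = 1 ^ n := fun n => truncPow_of_nonneg n zero_le_one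
  have h2 : ∀ n : ℕ, truncPow n 2 = 2 ^ n := fun n => truncPow_of_nonneg n zero_le_two
  have h3 : ∀ n : ℕ, truncPow n 3 = 3 ^ n := fun n => truncPow_of_nonneg n (by norm_num)
  have hm : ∀ (n : ℕ) (x : ℝ), n ≠ 0 → x < 0 → truncPow n x = 0 :=
    fun n x hn hx => truncPow_of_nonpos hn hx.le
  have d0 := fun x => congrFun ((iteratedDeriv_zero (f := bspline 4)).trans bspline_four) x
  have d1 := congrFun iteratedDeriv_one_bspline_four
  have d2 := congrFun iteratedDeriv_two_bspline_four
  fin_cases i <;> simp only [Fin.zero_eta, Fin.mk_one, Fin.reduceFinMk, d0, d1, d2] <;>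
    fin_cases j <;> simp only [nodeMatrix, Matrix.of_apply, Matrix.cons_val, Fin.zero_eta,
      Fin.mk_one, Fin.reduceFinMk] <;> norm_num [splineSum, h0, h1, h2, h3, hm]

lemma Psi_bspline_four (t : ℝ) :
    Psi (bspline 4) 0 3 t = Complex.exp (2 * (Real.pi : ℂ) * Complex.I * (t : ℂ)) • nodeMatrix := by
  ext i j
  simp only [Psi, Matrix.of_apply, Matrix.smul_apply, smul_eq_mul]
  rw [tsum_eq_single (1 : ℤ)]
  · rw [← iteratedDeriv_bspline_four_node]
    norm_num [mul_comm]
  · intro k hk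
    have hj : ((j : ℕ) : ℝ) ≤ 2 := by exact_mod_cast Nat.le_of_lt_succ j.2
    have hj0 : (0 : ℝ) ≤ ((j : ℕ) : ℝ) := Nat.cast_nonneg _
    rw [iteratedDeriv_bspline_four_eq_zero, Complex.ofReal_zero, zero_mul]
    rcases lt_or_gt_of_ne hk with h | h
    · left
      have : (k : ℝ) ≤ 0 := by exact_mod_cast Int.lt_add_one_iff.mp h
      push_cast; linarith
    · right
      have : (2 : ℝ) ≤ k := by exact_mod_cast h
      push_cast; linarith

lemma Psi_bspline_four_mul (t : ℝ) : Psi (bspline 4) 0 3 t *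
    (Complex.exp (-(2 * (Real.pi : ℂ) * Complex.I * (t : ℂ))) • nodeMatrixInv) = 1 := by
  rw [Psi_bspline_four, Matrix.smul_mul, Matrix.mul_smul, nodeMatrix_mul_nodeMatrixInv, smul_smul,
    ← Complex.exp_add, add_neg_cancel, Complex.exp_zero, one_smul]

lemma isUnit_det_Psi_bspline_four (t : ℝ) : IsUnit (Psi (bspline 4) 0 3 t).det :=
  (Matrix.isUnit_iff_isUnit_det _).mp (IsUnit.of_mul_eq_one _ (Psi_bspline_four_mul t))

lemma integral_exp_two_pi_int {n : ℤ} (hn : n ≠ 0) :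
    ∫ t in (0 : ℝ)..1, Complex.exp (2 * (Real.pi : ℂ) * Complex.I * (n : ℂ) * (t : ℂ)) = 0 := by
  have hc : 2 * (Real.pi : ℂ) * Complex.I * (n : ℂ) ≠ 0 := by
    simp [Real.pi_ne_zero, hn]
  rw [integral_exp_mul_complex hc]
  have := Complex.exp_int_mul_two_pi_mul_I n
  rw [show 2 * (Real.pi : ℂ) * Complex.I * (n : ℂ) * ((1 : ℝ) : ℂ) =
    n * (2 * Real.pi * Complex.I) by push_cast; ring, this]
  simp

/-- The inverse symbol is `e^{-2πit}` times a constant matrix, so orthogonality of the exponentials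
leaves only `v = -1`. -/
lemma psiInvCoeff_bspline_four (j i : Fin 3) (v : ℤ) :
    psiInvCoeff (bspline 4) 0 3 j i v = if v = -1 then nodeMatrixInv j i else 0 := by
  have h : ∀ t : ℝ, (Psi (bspline 4) 0 3 t)⁻¹ j i *
      Complex.exp (-(2 * (Real.pi : ℂ) * Complex.I * (v : ℂ) * (t : ℂ))) =
      nodeMatrixInv j i *
        Complex.exp (2 * (Real.pi : ℂ) * Complex.I * ((-1 - v : ℤ) : ℂ) * (t : ℂ)) := by
    intro t
    rw [Matrix.inv_eq_right_inv (Psi_bspline_four_mul t), Matrix.smul_apply, smul_eq_mul,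
      mul_comm (Complex.exp _) (nodeMatrixInv j i), mul_assoc, ← Complex.exp_add]
    congr 2
    push_cast; ring
  simp only [psiInvCoeff, h, intervalIntegral.integral_const_mul]
  split_ifs with hv
  · simp [hv]
  · rw [integral_exp_two_pi_int (by omega), mul_zero]

/-! ### Reconstruction functions and locality of the series. -/

lemma Theta_bspline_four (i : Fin 3) (t : ℝ) :
    Theta (bspline 4) 0 3 i t = nodeMatrixInv 0 i * ((splineSum 3 (t + 3) / 6 : ℝ) : ℂ) +
      nodeMatrixInv 1 i * ((splineSum 3 (t + 2) / 6 : ℝ) : ℂ) +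
      nodeMatrixInv 2 i * ((splineSum 3 (t + 1) / 6 : ℝ) : ℂ) := by
  simp only [Theta, psiInvCoeff_bspline_four]
  rw [tsum_eq_single (-1 : ℤ) (fun v hv => by simp [hv]), Fin.sum_univ_three]
  simp only [if_true, bspline_four]
  rw [show t - ((3 : ℕ) : ℝ) * ((-1 : ℤ) : ℝ) - (((0 : Fin 3) : ℕ) : ℝ) = t + 3 by norm_num,
    show t - ((3 : ℕ) : ℝ) * ((-1 : ℤ) : ℝ) - (((1 : Fin 3) : ℕ) : ℝ) = t + 2 by norm_num; ring,
    show t - ((3 : ℕ) : ℝ) * ((-1 : ℤ) : ℝ) - (((2 : Fin 3) : ℕ) : ℝ) = t + 1 by norm_num; ring]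

lemma continuous_Theta_bspline_four (i : Fin 3) : Continuous (Theta (bspline 4) 0 3 i) := by
  rw [show Theta (bspline 4) 0 3 i = _ from funext (Theta_bspline_four i)]
  fun_prop

lemma Theta_bspline_four_eq_zero (i : Fin 3) {t : ℝ} (ht : t ≤ -3 ∨ 3 ≤ t) :
    Theta (bspline 4) 0 3 i t = 0 := by
  have h : ∀ c : ℝ, 1 ≤ c → c ≤ 3 → splineSum 3 (t + c) = 0 := fun c h1 h3 =>
    ht.elim (fun h => splineSum_of_nonpos three_ne_zero (by linarith))
      (fun h => splineSum_of_four_le (by norm_num) (by linarith))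
  rw [Theta_bspline_four, h 3 (by norm_num) le_rfl, h 2 (by norm_num) (by norm_num),
    h 1 le_rfl (by norm_num)]
  simp

lemma samplingTerm_eq_zero (f : ℝ → ℂ) {W t : ℝ} {l : ℤ}
    (h : W * t - 3 * l ≤ -3 ∨ 3 ≤ W * t - 3 * l) :
    samplingTerm (bspline 4) 0 3 W f t l = 0 := by
  simp only [samplingTerm]
  refine Finset.sum_eq_zero fun i _ => ?_
  rw [Theta_bspline_four_eq_zero i (by exact_mod_cast h), mul_zero]

/-- Since the reconstruction functions vanish also at `±3`, the closed cell meets the supports of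
the terms of its two end nodes only. -/
lemma hasSum_samplingTerm (f : ℝ → ℂ) {W t : ℝ} {l : ℤ} (h0 : 3 * l ≤ W * t)
    (h1 : W * t ≤ 3 * l + 3) : HasSum (samplingTerm (bspline 4) 0 3 W f t)
      (samplingTerm (bspline 4) 0 3 W f t l + samplingTerm (bspline 4) 0 3 W f t (l + 1)) := by
  rw [← Finset.sum_pair (f := samplingTerm (bspline 4) 0 3 W f t) (by omega : l ≠ l + 1)]
  refine hasSum_sum_of_ne_finset_zero fun k hk => samplingTerm_eq_zero f ?_
  simp only [Finset.mem_insert, Finset.mem_singleton, not_or] at hk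
  rcases lt_or_gt_of_ne hk.1 with h | h
  · right
    have : (k : ℝ) ≤ l - 1 := by exact_mod_cast Int.le_sub_one_of_lt h
    linarith
  · left
    have : (l : ℝ) + 2 ≤ k := by exact_mod_cast (by omega : l + 2 ≤ k)
    linarith

lemma three_mul_floor_le (s : ℝ) : 3 * (⌊s / 3⌋ : ℝ) ≤ s := by
  linarith [Int.floor_le (s / 3)]

lemma le_three_mul_floor_add (s : ℝ) : s ≤ 3 * (⌊s / 3⌋ : ℝ) + 3 := by
  linarith [Int.lt_floor_add_one (s / 3)]

/-! ### Hermite identities and polynomial reproduction. -/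

lemma splineSum_three_pieces {u : ℝ} (h0 : 0 ≤ u) (h1 : u ≤ 1) :
    splineSum 3 u = u ^ 3 ∧ splineSum 3 (u + 1) = -3 * u ^ 3 + 3 * u ^ 2 + 3 * u + 1 ∧
    splineSum 3 (u + 2) = 3 * u ^ 3 - 6 * u ^ 2 + 4 ∧ splineSum 3 (u + 3) = (1 - u) ^ 3 := by
  have hp : ∀ x : ℝ, 0 ≤ x → truncPow 3 x = x ^ 3 := fun x h => truncPow_of_nonneg 3 h
  have hn : ∀ x : ℝ, x ≤ 0 → truncPow 3 x = 0 := fun x h => truncPow_of_nonpos three_ne_zero h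
  simp only [splineSum]
  refine ⟨?_, ?_, ?_, ?_⟩
  · rw [hp u h0, hn (u - 1) (by linarith), hn (u - 2) (by linarith), hn (u - 3) (by linarith),
      hn (u - 4) (by linarith)]
    ring
  · rw [hp (u + 1) (by linarith), hp (u + 1 - 1) (by linarith), hn (u + 1 - 2) (by linarith),
      hn (u + 1 - 3) (by linarith), hn (u + 1 - 4) (by linarith)]
    ring
  · rw [hp (u + 2) (by linarith), hp (u + 2 - 1) (by linarith), hp (u + 2 - 2) (by linarith),
      hn (u + 2 - 3) (by linarith), hn (u + 2 - 4) (by linarith)]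
    ring
  · rw [hp (u + 3) (by linarith), hp (u + 3 - 1) (by linarith), hp (u + 3 - 2) (by linarith),
      hp (u + 3 - 3) (by linarith), hn (u + 3 - 4) (by linarith)]
    ring

/-- On `[0, 3]` the Hermite spline operator with nodes `0` and `3` reproduces cubic polynomials. -/
lemma Theta_bspline_four_identities {s : ℝ} (h0 : 0 ≤ s) (h3 : s ≤ 3) :
    Theta (bspline 4) 0 3 0 s + Theta (bspline 4) 0 3 0 (s - 3) = 1 ∧
    Theta (bspline 4) 0 3 1 s + 3 * Theta (bspline 4) 0 3 0 (s - 3) +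
      Theta (bspline 4) 0 3 1 (s - 3) = s ∧
    2 * Theta (bspline 4) 0 3 2 s + 9 * Theta (bspline 4) 0 3 0 (s - 3) +
      6 * Theta (bspline 4) 0 3 1 (s - 3) + 2 * Theta (bspline 4) 0 3 2 (s - 3) = (s : ℂ) ^ 2 ∧
    27 * Theta (bspline 4) 0 3 0 (s - 3) + 27 * Theta (bspline 4) 0 3 1 (s - 3) +
      18 * Theta (bspline 4) 0 3 2 (s - 3) = (s : ℂ) ^ 3 := by
  have hn : ∀ x : ℝ, x ≤ 0 → splineSum 3 x = 0 := fun x => splineSum_of_nonpos three_ne_zero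
  have hp : ∀ x : ℝ, 4 ≤ x → splineSum 3 x = 0 := fun x => splineSum_of_four_le (by norm_num)
  have e1 : s - 3 + 3 = s := by ring
  have e2 : s - 3 + 2 = s - 1 := by ring
  have e3 : s - 3 + 1 = s - 2 := by ring
  simp only [Theta_bspline_four, nodeMatrixInv, e1, e2, e3, Matrix.of_apply, Matrix.cons_val]
  -- The knots `1` and `2` cut the cell into three intervals, on each of which both sides are
  -- polynomials.
  rcases le_total s 1 with h1 | h1
  · obtain ⟨p0, p1, p2, p3⟩ := splineSum_three_pieces h0 h1
    rw [p0, p1, p2, p3, hn (s - 1) (by linarith), hn (s - 2) (by linarith)]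
    push_cast
    refine ⟨?_, ?_, ?_, ?_⟩ <;> ring
  rcases le_total s 2 with h2 | h2
  · obtain ⟨u, rfl⟩ : ∃ u, s = u + 1 := ⟨s - 1, by ring⟩
    obtain ⟨p0, p1, p2, p3⟩ := splineSum_three_pieces (u := u) (by linarith) (by linarith)
    rw [hp (u + 1 + 3) (by linarith), show u + 1 + 2 = u + 3 by ring,
      show u + 1 + 1 = u + 2 by ring, show u + 1 - 1 = u by ring, p0, p1, p2, p3,
      hn (u + 1 - 2) (by linarith)]
    push_cast
    refine ⟨?_, ?_, ?_, ?_⟩ <;> ring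
  · obtain ⟨u, rfl⟩ : ∃ u, s = u + 2 := ⟨s - 2, by ring⟩
    obtain ⟨p0, p1, p2, p3⟩ := splineSum_three_pieces (u := u) (by linarith) (by linarith)
    rw [hp (u + 2 + 3) (by linarith), hp (u + 2 + 2) (by linarith),
      show u + 2 + 1 = u + 3 by ring, show u + 2 - 1 = u + 1 by ring,
      show u + 2 - 2 = u by ring, p0, p1, p2, p3]
    push_cast
    refine ⟨?_, ?_, ?_, ?_⟩ <;> ring

lemma samplingTerm_bspline_four (f : ℝ → ℂ) (W t : ℝ) (l : ℤ) :
    samplingTerm (bspline 4) 0 3 W f t l =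
      f (3 * l / W) * Theta (bspline 4) 0 3 0 (W * t - 3 * l) +
      1 / (W : ℂ) * iteratedDeriv 1 f (3 * l / W) * Theta (bspline 4) 0 3 1 (W * t - 3 * l) +
      1 / (W : ℂ) ^ 2 * iteratedDeriv 2 f (3 * l / W) *
        Theta (bspline 4) 0 3 2 (W * t - 3 * l) := by
  simp only [samplingTerm, Fin.sum_univ_three, Fin.coe_ofNat_eq_mod, Nat.zero_mod, Nat.one_mod,
    Nat.mod_succ, iteratedDeriv_zero, pow_zero, pow_one, div_one, one_mul, zero_add, Nat.cast_ofNat]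

/-- On each cell, the sampling operator is the Taylor polynomial at the left node plus a
correction built from the Taylor remainders at the right node. -/
lemma samplingOp_eq_taylor_add (f : ℝ → ℂ) {W t : ℝ} {l : ℤ} (h0 : 3 * l ≤ W * t)
    (h1 : W * t ≤ 3 * l + 3) {a b : Fin 3 → ℂ}
    (ha : ∀ i : Fin 3, a i = 1 / (W : ℂ) ^ (i : ℕ) * iteratedDeriv i f (3 * l / W))
    (hb : ∀ i : Fin 3, b i = 1 / (W : ℂ) ^ (i : ℕ) * iteratedDeriv i f ((3 * l + 3) / W))
    {s : ℝ} (hs : s = W * t - 3 * l) :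
    samplingOp (bspline 4) 0 3 W f t = a 0 + a 1 * s + a 2 / 2 * s ^ 2 +
      (b 0 - a 0 - 3 * a 1 - 9 / 2 * a 2) * Theta (bspline 4) 0 3 0 (s - 3) +
      (b 1 - a 1 - 3 * a 2) * Theta (bspline 4) 0 3 1 (s - 3) +
      (b 2 - a 2) * Theta (bspline 4) 0 3 2 (s - 3) := by
  have a0 := ha 0
  have a1 := ha 1
  have a2 := ha 2
  have b0 := hb 0
  have b1 := hb 1
  have b2 := hb 2
  simp only [Fin.coe_ofNat_eq_mod, Nat.zero_mod, Nat.one_mod, Nat.mod_succ, pow_zero, div_one,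
    one_mul, iteratedDeriv_zero, pow_one] at a0 a1 a2 b0 b1 b2
  rw [samplingOp, (hasSum_samplingTerm f h0 h1).tsum_eq, samplingTerm_bspline_four,
    samplingTerm_bspline_four, ← hs, show (3 * ((l + 1 : ℤ) : ℝ)) = 3 * l + 3 by push_cast; ring,
    show W * t - (3 * l + 3) = s - 3 by rw [hs]; ring, ← a0, ← a1, ← a2, ← b0, ← b1, ← b2]
  obtain ⟨i0, i1, i2, -⟩ := Theta_bspline_four_identities (s := s) (by linarith) (by linarith)
  -- The Taylor polynomial at the left node has degree two, so the identities for `1`, `s`, `s²`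
  -- suffice.
  linear_combination a 0 * i0 + a 1 * i1 + a 2 / 2 * i2

lemma summable_samplingTerm (f : ℝ → ℂ) (W t : ℝ) :
    Summable (samplingTerm (bspline 4) 0 3 W f t) :=
  (hasSum_samplingTerm f (three_mul_floor_le (W * t)) (le_three_mul_floor_add (W * t))).summable

lemma iteratedDeriv_one_polynomial (P : Polynomial ℂ) :
    iteratedDeriv 1 (fun x : ℝ => P.eval (x : ℂ)) = fun x : ℝ => P.derivative.eval (x : ℂ) := by
  rw [iteratedDeriv_one]
  ext x
  exact (P.hasDerivAt (x : ℂ)).comp_ofReal.deriv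

lemma iteratedDeriv_two_polynomial (P : Polynomial ℂ) :
    iteratedDeriv 2 (fun x : ℝ => P.eval (x : ℂ)) =
      fun x : ℝ => P.derivative.derivative.eval (x : ℂ) := by
  rw [iteratedDeriv_succ, iteratedDeriv_one_polynomial, ← iteratedDeriv_one,
    iteratedDeriv_one_polynomial]

theorem reproducesPolynomials_bspline_four : ReproducesPolynomials (bspline 4) 0 3 3 := by
  intro P hP W hW t
  have hW0 : (W : ℂ) ≠ 0 := by exact_mod_cast (by linarith : W ≠ 0)
  obtain ⟨s, hs⟩ : ∃ s, s = W * t - 3 * (⌊W * t / 3⌋ : ℤ) := ⟨_, rfl⟩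
  have h0 := three_mul_floor_le (W * t)
  have h1 := le_three_mul_floor_add (W * t)
  set l := ⌊W * t / 3⌋
  rw [samplingOp_eq_taylor_add _ h0 h1 (fun _ => rfl) (fun _ => rfl) hs]
  obtain ⟨-, -, -, i3⟩ := Theta_bspline_four_identities (s := s) (by linarith) (by linarith)
  have ht : (t : ℂ) = (3 * l + s) / W := by
    rw [eq_div_iff hW0, hs]; push_cast; ring
  simp only [Fin.coe_ofNat_eq_mod, Nat.zero_mod, Nat.one_mod, Nat.mod_succ, iteratedDeriv_zero,
    iteratedDeriv_one_polynomial, iteratedDeriv_two_polynomial, ht]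
  rw [P.as_sum_range_C_mul_X_pow' (n := 4) (by omega)]
  simp only [Finset.sum_range_succ, Finset.sum_range_zero, map_add, map_zero,
    Polynomial.derivative_C_mul_X_pow, Polynomial.eval_add, Polynomial.eval_mul, Polynomial.eval_C,
    Polynomial.eval_pow, Polynomial.eval_X, Polynomial.eval_zero]
  push_cast
  field_simp
  norm_num
  -- Only the cubic coefficient survives in the Taylor remainders; the factor `2` comes from
  -- clearing denominators.
  linear_combination 2 * P.coeff 3 * i3

/-! ### Third differences control the oscillation of the second derivative. -/

lemma fdiff_three (F : ℝ → ℂ) (h t : ℝ) :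
    fdiff 3 h F t = F (t + 3 * h) - 3 * F (t + 2 * h) + 3 * F (t + h) - F t := by
  simp [fdiff, Finset.sum_range_succ, Nat.choose]
  ring

/-- A four-point one-sided numerical derivative, exact for cubic polynomials. -/
noncomputable def numDeriv (F : ℝ → ℂ) (x : ℝ) : ℂ :=
  3 * (F (x + 1) - F x) - 3 / 2 * (F (x + 2) - F x) + 1 / 3 * (F (x + 3) - F x)

/-- The weights `3, -3/2, 1/3` at `x + h, x + 2h, x + 3h` are chosen so that differentiating in `h`
and subtracting `F' x` gives exactly `fdiff 3 h F' x`. The mean value inequality on `[0,1]` finishes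
without any continuity of `F'`. -/
lemma norm_deriv_sub_numDeriv_le {F F' : ℝ → ℂ} (hF : ∀ x, HasDerivAt F (F' x) x) {x B : ℝ}
    (hB : ∀ h ∈ Set.Icc (0 : ℝ) 1, ‖fdiff 3 h F' x‖ ≤ B) : ‖F' x - numDeriv F x‖ ≤ B := by
  have hd : ∀ c h : ℝ, HasDerivAt (fun h : ℝ => F (x + c * h)) (c * F' (x + c * h)) h := by
    intro c h
    have h1 : HasDerivAt (fun h : ℝ => x + c * h) c h := by
      simpa using ((hasDerivAt_id h).const_mul c).const_add x
    simpa [Function.comp_def] using (hF (x + c * h)).scomp h h1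
  have hφ : ∀ h : ℝ, HasDerivAt (fun h : ℝ => 3 * F (x + 1 * h) - 3 / 2 * F (x + 2 * h) +
      1 / 3 * F (x + 3 * h) - (h : ℂ) * F' x) (fdiff 3 h F' x) h := by
    intro h
    have h1 := ((((hd 1 h).const_mul 3).sub ((hd 2 h).const_mul (3 / 2))).add
      ((hd 3 h).const_mul (1 / 3))).sub ((hasDerivAt_id h).ofReal_comp.mul_const (F' x))
    refine h1.congr_deriv ?_
    rw [fdiff_three]
    push_cast
    ring_nf
  have := norm_image_sub_le_of_norm_deriv_le_segment_01' (fun h _ => (hφ h).hasDerivWithinAt)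
    (fun h hh => hB h ⟨hh.1, hh.2.le⟩)
  rw [← norm_neg]
  refine le_of_eq_of_le (congrArg _ ?_) this
  simp only [numDeriv]
  push_cast
  simp only [mul_one, mul_zero, add_zero]
  ring

/-- Mixed third differences are combinations of pure ones. -/
lemma mixedDiff_eq (F : ℝ → ℂ) (u y : ℝ) :
    F (y + 2 + u) - 2 * F (y + 1 + u) + F (y + u) - (F (y + 2) - 2 * F (y + 1) + F y) =
      -fdiff 3 (-1) F (y + 1) - fdiff 3 (-1 / 2) F (y + 1) - fdiff 3 (-u / 3) F (y + u) +
      fdiff 3 (-3 / 2) F (y + 2) + fdiff 3 (-1 - u / 3) F (y + 1 + u) +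
      fdiff 3 (-1 / 2 - u / 3) F (y + 1 + u) - fdiff 3 (-3 / 2 - u / 3) F (y + 2 + u) := by
  -- This is Kemperman's identity for the steps `h₁ = 1`, `h₂ = 1`, `h₃ = u`: each nonempty subset
  -- `D` contributes, up to sign, a pure difference of step `-∑ hᵢ/i` based at `y + ∑ hᵢ`, both sums
  -- over `D`. The seven subsets give the factor `7` in the norm bound.
  simp only [fdiff_three]
  ring_nf

lemma norm_mixedDiff_le {F : ℝ → ℂ} {B : ℝ} (hB : ∀ t h : ℝ, t ∈ Set.Icc (-3 : ℝ) 9 →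
      t + 3 * h ∈ Set.Icc (-3 : ℝ) 9 → ‖fdiff 3 h F t‖ ≤ B)
    {u y : ℝ} (hu0 : 0 ≤ u) (hu3 : u ≤ 3) (hy0 : 0 ≤ y) (hy4 : y ≤ 4) :
    ‖F (y + 2 + u) - 2 * F (y + 1 + u) + F (y + u) - (F (y + 2) - 2 * F (y + 1) + F y)‖ ≤
      7 * B := by
  have h1 := hB (y + 1) (-1) ⟨by linarith, by linarith⟩ ⟨by linarith, by linarith⟩
  have h2 := hB (y + 1) (-1 / 2) ⟨by linarith, by linarith⟩ ⟨by linarith, by linarith⟩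
  have h3 := hB (y + u) (-u / 3) ⟨by linarith, by linarith⟩ ⟨by linarith, by linarith⟩
  have h4 := hB (y + 2) (-3 / 2) ⟨by linarith, by linarith⟩ ⟨by linarith, by linarith⟩
  have h5 := hB (y + 1 + u) (-1 - u / 3) ⟨by linarith, by linarith⟩ ⟨by linarith, by linarith⟩
  have h6 := hB (y + 1 + u) (-1 / 2 - u / 3) ⟨by linarith, by linarith⟩ ⟨by linarith, by linarith⟩
  have h7 := hB (y + 2 + u) (-3 / 2 - u / 3) ⟨by linarith, by linarith⟩ ⟨by linarith, by linarith⟩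
  rw [mixedDiff_eq]
  rw [← norm_neg] at h1
  exact (norm_sub_le_of_le (norm_add_le_of_le (norm_add_le_of_le (norm_add_le_of_le
    (norm_sub_le_of_le (norm_sub_le_of_le h1 h2) h3) h4) h5) h6) h7).trans (by linarith)

lemma norm_mul_le_of_le_real {c z : ℂ} {a b : ℝ} (hc : ‖c‖ ≤ a) (hz : ‖z‖ ≤ b) :
    ‖c * z‖ ≤ a * b := by
  rw [norm_mul]
  exact mul_le_mul hc hz (norm_nonneg _) ((norm_nonneg _).trans hc)

lemma norm_numDeriv_le {F : ℝ → ℂ} {x B : ℝ} (h0 : ‖F x‖ ≤ B) (h1 : ‖F (x + 1)‖ ≤ B)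
    (h2 : ‖F (x + 2)‖ ≤ B) (h3 : ‖F (x + 3)‖ ≤ B) : ‖numDeriv F x‖ ≤ 7 * B := by
  have e : numDeriv F x = 3 * F (x + 1) - 3 / 2 * F (x + 2) + 1 / 3 * F (x + 3) -
      11 / 6 * F x := by simp only [numDeriv]; ring
  have hB := (norm_nonneg _).trans h0
  rw [e]
  refine (norm_sub_le_of_le (norm_add_le_of_le (norm_sub_le_of_le
    (norm_mul_le_of_le_real (a := 3) (by norm_num) h1)
    (norm_mul_le_of_le_real (a := 3 / 2) (by norm_num) h2))
    (norm_mul_le_of_le_real (a := 1 / 3) (by norm_num) h3))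
    (norm_mul_le_of_le_real (a := 11 / 6) (by norm_num) h0)).trans (by linarith)

/-- In terms of the unit shift `E`, `numDeriv` is `(E - 1)(E²/3 - 7E/6 + 11/6)`. Its square is `(E -
1)²` times a quartic whose coefficients are those below, so the increment is a combination of mixed
differences based at `0, …, 4`. The absolute values of these coefficients sum to `100/9`, and `7 ·
100/9 < 84`. -/
lemma norm_numDeriv_numDeriv_sub_le {F : ℝ → ℂ} {B : ℝ} (hB : ∀ t h : ℝ, t ∈ Set.Icc (-3 : ℝ) 9 →
      t + 3 * h ∈ Set.Icc (-3 : ℝ) 9 → ‖fdiff 3 h F t‖ ≤ B) {u : ℝ} (hu0 : 0 ≤ u) (hu3 : u ≤ 3) :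
    ‖numDeriv (numDeriv F) u - numDeriv (numDeriv F) 0‖ ≤ 84 * B := by
  have hB0 : 0 ≤ B := (norm_nonneg _).trans (hB 0 0 (by norm_num) (by norm_num))
  have m := fun (y : ℝ) => norm_mixedDiff_le (y := y) hB hu0 hu3
  have e : numDeriv (numDeriv F) u - numDeriv (numDeriv F) 0 =
      121 / 36 * (F (0 + 2 + u) - 2 * F (0 + 1 + u) + F (0 + u) -
        (F (0 + 2) - 2 * F (0 + 1) + F 0)) -
      77 / 18 * (F (1 + 2 + u) - 2 * F (1 + 1 + u) + F (1 + u) -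
        (F (1 + 2) - 2 * F (1 + 1) + F 1)) +
      93 / 36 * (F (2 + 2 + u) - 2 * F (2 + 1 + u) + F (2 + u) -
        (F (2 + 2) - 2 * F (2 + 1) + F 2)) -
      7 / 9 * (F (3 + 2 + u) - 2 * F (3 + 1 + u) + F (3 + u) -
        (F (3 + 2) - 2 * F (3 + 1) + F 3)) +
      1 / 9 * (F (4 + 2 + u) - 2 * F (4 + 1 + u) + F (4 + u) -
        (F (4 + 2) - 2 * F (4 + 1) + F 4)) := by
    simp only [numDeriv]
    ring_nf
  rw [e]
  refine (norm_add_le_of_le (norm_sub_le_of_le (norm_add_le_of_le (norm_sub_le_of_le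
    (norm_mul_le_of_le_real (a := 121 / 36) (by norm_num) (m 0 (by norm_num) (by norm_num)))
    (norm_mul_le_of_le_real (a := 77 / 18) (by norm_num) (m 1 (by norm_num) (by norm_num))))
    (norm_mul_le_of_le_real (a := 93 / 36) (by norm_num) (m 2 (by norm_num) (by norm_num))))
    (norm_mul_le_of_le_real (a := 7 / 9) (by norm_num) (m 3 (by norm_num) (by norm_num))))
    (norm_mul_le_of_le_real (a := 1 / 9) (by norm_num) (m 4 (by norm_num) (by norm_num)))).trans
    (by linarith)

/-- The oscillation of the second derivative is controlled by the third differences of the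
function and of its first two derivatives. -/
lemma norm_second_deriv_sub_le {F : ℕ → ℝ → ℂ} (h01 : ∀ x, HasDerivAt (F 0) (F 1 x) x)
    (h12 : ∀ x, HasDerivAt (F 1) (F 2 x) x) {B : ℝ}
    (hB : ∀ i < 3, ∀ t h : ℝ, t ∈ Set.Icc (-3 : ℝ) 9 → t + 3 * h ∈ Set.Icc (-3 : ℝ) 9 →
      ‖fdiff 3 h (F i) t‖ ≤ B) {u : ℝ} (hu0 : 0 ≤ u) (hu3 : u ≤ 3) :
    ‖F 2 u - F 2 0‖ ≤ 100 * B := by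
  have h2 : ∀ x, 0 ≤ x → x ≤ 6 → ‖F 2 x - numDeriv (F 1) x‖ ≤ B := fun x hx0 hx6 =>
    norm_deriv_sub_numDeriv_le h12 fun h hh => hB 2 (by norm_num) x h
      ⟨by linarith, by linarith⟩ ⟨by linarith [hh.1], by linarith [hh.2]⟩
  have h1 : ∀ x, 0 ≤ x → x ≤ 6 → ‖F 1 x - numDeriv (F 0) x‖ ≤ B := fun x hx0 hx6 =>
    norm_deriv_sub_numDeriv_le h01 fun h hh => hB 1 (by norm_num) x h
      ⟨by linarith, by linarith⟩ ⟨by linarith [hh.1], by linarith [hh.2]⟩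
  have h11 : ∀ x, 0 ≤ x → x ≤ 3 →
      ‖numDeriv (fun y => F 1 y - numDeriv (F 0) y) x‖ ≤ 7 * B := fun x hx0 hx3 =>
    norm_numDeriv_le (h1 x hx0 (by linarith)) (h1 (x + 1) (by linarith) (by linarith))
      (h1 (x + 2) (by linarith) (by linarith)) (h1 (x + 3) (by linarith) (by linarith))
  -- Both derivatives are replaced by difference quotients; the errors add up to `1 + 1 + 7 + 7 + 84
  -- = 100` times `B`.
  have e : F 2 u - F 2 0 = (F 2 u - numDeriv (F 1) u) - (F 2 0 - numDeriv (F 1) 0) +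
      numDeriv (fun y => F 1 y - numDeriv (F 0) y) u -
      numDeriv (fun y => F 1 y - numDeriv (F 0) y) 0 +
      (numDeriv (numDeriv (F 0)) u - numDeriv (numDeriv (F 0)) 0) := by
    simp only [numDeriv]; ring_nf
  rw [e]
  refine (norm_add_le_of_le (norm_sub_le_of_le (norm_add_le_of_le (norm_sub_le_of_le
    (h2 u hu0 (by linarith)) (h2 0 le_rfl (by norm_num))) (h11 u hu0 hu3))
    (h11 0 le_rfl (by norm_num)))
    (norm_numDeriv_numDeriv_sub_le (hB 0 (by norm_num)) hu0 hu3)).trans (by linarith)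

/-- The mean value inequality is applied twice on an interval of length `3`, gaining a factor `3`
each time. -/
lemma norm_taylor_remainder_le {F : ℕ → ℝ → ℂ} (h01 : ∀ x, HasDerivAt (F 0) (F 1 x) x)
    (h12 : ∀ x, HasDerivAt (F 1) (F 2 x) x) {D : ℝ}
    (hD : ∀ u, 0 ≤ u → u ≤ 3 → ‖F 2 u - F 2 0‖ ≤ D) {u : ℝ} (hu0 : 0 ≤ u) (hu3 : u ≤ 3) :
    ‖F 1 u - F 1 0 - u * F 2 0‖ ≤ 3 * D ∧
      ‖F 0 u - F 0 0 - u * F 1 0 - u ^ 2 / 2 * F 2 0‖ ≤ 9 * D := by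
  have hD0 : 0 ≤ D := (norm_nonneg _).trans (hD 0 le_rfl (by norm_num))
  have d1 : ∀ x : ℝ, HasDerivAt (fun x : ℝ => F 1 x - F 1 0 - x * F 2 0) (F 2 x - F 2 0) x := by
    intro x
    have := ((h12 x).sub_const (F 1 0)).sub ((hasDerivAt_id x).ofReal_comp.mul_const (F 2 0))
    refine this.congr_deriv ?_
    simp
  have b1 : ∀ x : ℝ, 0 ≤ x → x ≤ 3 → ‖F 1 x - F 1 0 - x * F 2 0‖ ≤ 3 * D := by
    intro x hx0 hx3
    have := norm_image_sub_le_of_norm_deriv_le_segment' (a := 0) (b := 3)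
      (fun y _ => (d1 y).hasDerivWithinAt) (fun y hy => hD y hy.1 hy.2.le) x ⟨hx0, hx3⟩
    simp only [Complex.ofReal_zero, zero_mul, sub_self, sub_zero] at this
    nlinarith
  have d0 : ∀ x : ℝ, HasDerivAt (fun x : ℝ => F 0 x - F 0 0 - x * F 1 0 - x ^ 2 / 2 * F 2 0)
      (F 1 x - F 1 0 - x * F 2 0) x := by
    intro x
    have := (((h01 x).sub_const (F 0 0)).sub
      ((hasDerivAt_id x).ofReal_comp.mul_const (F 1 0))).sub
      (((((hasDerivAt_id x).ofReal_comp).pow 2).div_const 2).mul_const (F 2 0))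
    refine this.congr_deriv ?_
    simp
  refine ⟨b1 u hu0 hu3, ?_⟩
  have := norm_image_sub_le_of_norm_deriv_le_segment' (a := 0) (b := 3)
      (fun y _ => (d0 y).hasDerivWithinAt) (fun y hy => b1 y hy.1 hy.2.le) u ⟨hu0, hu3⟩
  simp only [Complex.ofReal_zero, zero_mul, sub_self, sub_zero, ne_eq, OfNat.ofNat_ne_zero,
    not_false_eq_true, zero_pow, zero_div] at this
  nlinarith

/-! ### Rescaling and the pointwise error bound. -/

lemma enorm_fdiff_le_localModulus {r : ℕ} {f : ℝ → ℂ} {x δ t h : ℝ}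
    (ht : t ∈ Set.Icc (x - r * δ / 2) (x + r * δ / 2))
    (hth : t + r * h ∈ Set.Icc (x - r * δ / 2) (x + r * δ / 2)) :
    ‖fdiff r h f t‖ₑ ≤ localModulus r f x δ :=
  le_iSup_of_le t <| le_iSup_of_le h <| le_iSup_of_le ht <| le_iSup_of_le hth le_rfl

lemma localModulus_mono {r : ℕ} {f : ℝ → ℂ} {x y δ ε : ℝ} (h1 : y - r * ε / 2 ≤ x - r * δ / 2)
    (h2 : x + r * δ / 2 ≤ y + r * ε / 2) : localModulus r f x δ ≤ localModulus r f y ε := by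
  have hs := Set.Icc_subset_Icc h1 h2
  exact iSup_le fun t => iSup_le fun h => iSup_le fun ht => iSup_le fun hth =>
    enorm_fdiff_le_localModulus (hs ht) (hs hth)

lemma exists_bound_Theta_bspline_four :
    ∃ K : ℝ, 0 ≤ K ∧ ∀ i, ∀ s ∈ Set.Icc (0 : ℝ) 3, ‖Theta (bspline 4) 0 3 i (s - 3)‖ ≤ K := by
  have h : ∀ i : Fin 3, ∃ K, ∀ s ∈ Set.Icc (0 : ℝ) 3, ‖Theta (bspline 4) 0 3 i (s - 3)‖ ≤ K :=
    fun i => isCompact_Icc.exists_bound_of_continuousOn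
      ((continuous_Theta_bspline_four i).comp (continuous_id.sub continuous_const)).continuousOn
  choose K hK using h
  have hK0 : ∀ i, 0 ≤ K i := fun i => (norm_nonneg _).trans (hK i 0 (by norm_num))
  exact ⟨∑ i, K i, Finset.sum_nonneg fun i _ => hK0 i, fun i s hs =>
    (hK i s hs).trans (Finset.single_le_sum (fun j _ => hK0 j) (Finset.mem_univ i))⟩

/-- The rescaled derivative `s ↦ W⁻ⁱ f⁽ⁱ⁾((3l + s) / W)`. -/
noncomputable def rescaled (f : ℝ → ℂ) (W : ℝ) (l : ℤ) (i : ℕ) (s : ℝ) : ℂ :=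
  1 / (W : ℂ) ^ i * iteratedDeriv i f ((3 * l + s) / W)

lemma hasDerivAt_rescaled {f : ℝ → ℂ} {i : ℕ} (hf : Differentiable ℝ (iteratedDeriv i f))
    (W : ℝ) (l : ℤ) (s : ℝ) :
    HasDerivAt (rescaled f W l i) (rescaled f W l (i + 1) s) s := by
  have h1 : HasDerivAt (fun s : ℝ => (3 * l + s) / W) (1 / W) s :=
    ((hasDerivAt_id s).const_add (3 * (l : ℝ))).div_const W
  have h2 := ((hf ((3 * l + s) / W)).hasDerivAt.scomp s h1).const_mul (1 / (W : ℂ) ^ i)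
  refine h2.congr_deriv ?_
  simp only [rescaled, iteratedDeriv_succ, Complex.real_smul]
  push_cast
  ring

lemma norm_fdiff_rescaled_le (f : ℝ → ℂ) {W : ℝ} (hW : 1 ≤ W) (l : ℤ) (i : ℕ) (h t : ℝ) :
    ‖fdiff 3 h (rescaled f W l i) t‖ ≤
      ‖fdiff 3 (h / W) (iteratedDeriv i f) ((3 * l + t) / W)‖ := by
  have e : fdiff 3 h (rescaled f W l i) t =
      1 / (W : ℂ) ^ i * fdiff 3 (h / W) (iteratedDeriv i f) ((3 * l + t) / W) := by
    simp only [fdiff_three, rescaled]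
    rw [show (3 * l + t) / W + 3 * (h / W) = (3 * l + (t + 3 * h)) / W by ring,
      show (3 * l + t) / W + 2 * (h / W) = (3 * l + (t + 2 * h)) / W by ring,
      show (3 * l + t) / W + h / W = (3 * l + (t + h)) / W by ring]
    ring
  rw [e, norm_mul]
  refine mul_le_of_le_one_left (norm_nonneg _) ?_
  rw [norm_div, norm_one, norm_pow, Complex.norm_real, Real.norm_of_nonneg (by linarith)]
  exact div_le_one_of_le₀ (one_le_pow₀ hW) (by positivity)

/-- Pointwise error estimate, with the moduli taken at the centre of the enlarged cell. -/
theorem exists_enorm_samplingOp_sub_le : ∃ K : ℝ≥0, ∀ f : ℝ → ℂ,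
    (∀ i < 2, Differentiable ℝ (iteratedDeriv i f)) → ∀ W : ℝ, 1 ≤ W → ∀ t : ℝ,
      ‖samplingOp (bspline 4) 0 3 W f t - f t‖ₑ ≤ K * ∑ i ∈ Finset.range 3,
        localModulus 3 (iteratedDeriv i f) ((3 * ⌊W * t / 3⌋ + 3) / W) (4 / W) := by
  obtain ⟨K, hK0, hK⟩ := exists_bound_Theta_bspline_four
  have hc : 0 < (13 * K + 9) * 100 := by positivity
  refine ⟨((13 * K + 9) * 100).toNNReal, fun f hf W hW t => ?_⟩
  have hW0 : 0 < W := by linarith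
  have h0 := three_mul_floor_le (W * t)
  have h1 := le_three_mul_floor_add (W * t)
  set l := ⌊W * t / 3⌋
  set M := ∑ i ∈ Finset.range 3,
    localModulus 3 (iteratedDeriv i f) ((3 * l + 3) / W) (4 / W) with hM
  -- An infinite modulus makes the bound trivial because the constant is positive; otherwise the
  -- estimate is carried out in the reals.
  by_cases hMt : M = ∞
  · rw [hMt, ENNReal.mul_top (by simpa using hc)]
    exact le_top
  obtain ⟨s, hs⟩ : ∃ s, s = W * t - 3 * l := ⟨_, rfl⟩
  have hB : ∀ i < 3, ∀ t h : ℝ, t ∈ Set.Icc (-3 : ℝ) 9 → t + 3 * h ∈ Set.Icc (-3 : ℝ) 9 →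
      ‖fdiff 3 h (rescaled f W l i) t‖ ≤ M.toReal := by
    intro i hi t h ht hth
    refine (norm_fdiff_rescaled_le f hW l i h t).trans ?_
    rw [← toReal_enorm]
    refine ENNReal.toReal_mono hMt (le_trans ?_ (Finset.single_le_sum
      (f := fun i => localModulus 3 (iteratedDeriv i f) ((3 * l + 3) / W) (4 / W))
      (fun _ _ => zero_le) (Finset.mem_range.mpr hi)))
    -- In cell coordinates `[-3,9]` has centre `3` and half-length `6 = 3 · 4 / 2`, which explains
    -- the centre and the scale `4 / W`.
    have hI : ∀ u ∈ Set.Icc (-3 : ℝ) 9, (3 * l + u) / W ∈ Set.Icc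
        ((3 * l + 3) / W - (3 : ℕ) * (4 / W) / 2) ((3 * l + 3) / W + (3 : ℕ) * (4 / W) / 2) := by
      intro u hu
      rw [show (3 * l + 3) / W - (3 : ℕ) * (4 / W) / 2 = (3 * l + -3) / W by push_cast; ring,
        show (3 * l + 3) / W + (3 : ℕ) * (4 / W) / 2 = (3 * l + 9) / W by push_cast; ring]
      exact ⟨by gcongr; exact hu.1, by gcongr; exact hu.2⟩
    refine enorm_fdiff_le_localModulus (hI t ht) ?_
    rw [show (3 * l + t) / W + (3 : ℕ) * (h / W) = (3 * l + (t + 3 * h)) / W by push_cast; ring]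
    exact hI _ hth
  have h01 : ∀ x, HasDerivAt (rescaled f W l 0) (rescaled f W l 1 x) x :=
    hasDerivAt_rescaled (hf 0 (by norm_num)) W l
  have h12 : ∀ x, HasDerivAt (rescaled f W l 1) (rescaled f W l 2 x) x :=
    hasDerivAt_rescaled (hf 1 (by norm_num)) W l
  have hD : ∀ u, 0 ≤ u → u ≤ 3 → ‖rescaled f W l 2 u - rescaled f W l 2 0‖ ≤ 100 * M.toReal :=
    fun u hu0 hu3 => norm_second_deriv_sub_le h01 h12 hB hu0 hu3
  have hft : f t = rescaled f W l 0 s := by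
    simp only [rescaled, pow_zero, div_one, one_mul, iteratedDeriv_zero]
    congr 1
    rw [eq_div_iff hW0.ne', hs]; ring
  have hS := samplingOp_eq_taylor_add f h0 h1 (a := fun i => rescaled f W l i 0)
    (b := fun i => rescaled f W l i 3) (fun i => by simp [rescaled]) (fun i => rfl) hs
  simp only [Fin.coe_ofNat_eq_mod, Nat.zero_mod, Nat.one_mod, Nat.mod_succ] at hS
  have hs0 : 0 ≤ s := by linarith
  have hs3 : s ≤ 3 := by linarith
  obtain ⟨-, r0⟩ := norm_taylor_remainder_le h01 h12 hD hs0 hs3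
  obtain ⟨r1, r2⟩ := norm_taylor_remainder_le h01 h12 hD (by norm_num : (0 : ℝ) ≤ 3) le_rfl
  have r3 := hD 3 (by norm_num) le_rfl
  have e : samplingOp (bspline 4) 0 3 W f t - f t =
      Theta (bspline 4) 0 3 0 (s - 3) * (rescaled f W l 0 3 - rescaled f W l 0 0 -
        (3 : ℝ) * rescaled f W l 1 0 - (3 : ℝ) ^ 2 / 2 * rescaled f W l 2 0) +
      Theta (bspline 4) 0 3 1 (s - 3) * (rescaled f W l 1 3 - rescaled f W l 1 0 -
        (3 : ℝ) * rescaled f W l 2 0) +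
      Theta (bspline 4) 0 3 2 (s - 3) * (rescaled f W l 2 3 - rescaled f W l 2 0) -
      (rescaled f W l 0 s - rescaled f W l 0 0 - s * rescaled f W l 1 0 -
        s ^ 2 / 2 * rescaled f W l 2 0) := by
    rw [hS, hft]; push_cast; ring
  -- The remainders at the right node contribute `9K + 3K + K`, and the one at `s` contributes `9`.
  have hle : ‖samplingOp (bspline 4) 0 3 W f t - f t‖ ≤ (13 * K + 9) * 100 * M.toReal := by
    rw [e]
    refine (norm_sub_le_of_le (norm_add_le_of_le (norm_add_le_of_le
      (norm_mul_le_of_le_real (hK 0 s ⟨hs0, hs3⟩) r2)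
      (norm_mul_le_of_le_real (hK 1 s ⟨hs0, hs3⟩) r1))
      (norm_mul_le_of_le_real (hK 2 s ⟨hs0, hs3⟩) r3)) r0).trans (le_of_eq (by ring))
  calc ‖samplingOp (bspline 4) 0 3 W f t - f t‖ₑ
      = ENNReal.ofReal ‖samplingOp (bspline 4) 0 3 W f t - f t‖ := (ofReal_norm _).symm
    _ ≤ ENNReal.ofReal ((13 * K + 9) * 100 * M.toReal) := ENNReal.ofReal_le_ofReal hle
    _ = ((13 * K + 9) * 100).toNNReal * M := by
        rw [ENNReal.ofReal_mul hc.le, ENNReal.ofReal_toReal hMt, ENNReal.ofReal]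

/-! ### Measurability and the `L^p` estimate. -/

lemma continuous_samplingTerm_bspline_four (f : ℝ → ℂ) (W : ℝ) (l : ℤ) :
    Continuous fun t => samplingTerm (bspline 4) 0 3 W f t l := by
  have h : ∀ i, Continuous fun t : ℝ => Theta (bspline 4) 0 3 i (W * t - 3 * (l : ℝ)) := fun i =>
    (continuous_Theta_bspline_four i).comp (by fun_prop)
  simp only [samplingTerm_bspline_four]
  exact ((continuous_const.mul (h 0)).add (continuous_const.mul (h 1))).add
    (continuous_const.mul (h 2))

lemma measurable_apply_of_countable {T : ℝ → ℤ → ℂ} (hT : ∀ l, Measurable fun t => T t l)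
    {k : ℝ → ℤ} (hk : Measurable k) : Measurable fun t => T t (k t) :=
  (measurable_from_prod_countable_left (f := fun q : ℝ × ℤ => T q.1 q.2) hT).comp
    (measurable_id.prodMk hk)

lemma measurable_samplingOp_bspline_four (f : ℝ → ℂ) (W : ℝ) :
    Measurable (samplingOp (bspline 4) 0 3 W f) := by
  have hl : Measurable fun t : ℝ => ⌊W * t / 3⌋ := by fun_prop
  have hT := fun l => (continuous_samplingTerm_bspline_four f W l).measurable
  have e : samplingOp (bspline 4) 0 3 W f = fun t =>
      samplingTerm (bspline 4) 0 3 W f t ⌊W * t / 3⌋ +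
        samplingTerm (bspline 4) 0 3 W f t (⌊W * t / 3⌋ + 1) := by
    ext t
    exact (hasSum_samplingTerm f (three_mul_floor_le (W * t))
      (le_three_mul_floor_add (W * t))).tsum_eq
  rw [e]
  exact (measurable_apply_of_countable hT hl).add
    (measurable_apply_of_countable hT (hl.add_const 1))

lemma lintegral_rpow_const_mul_sum_le {p : ℝ} (hp : 1 ≤ p) (K : ℝ≥0) {G : ℕ → ℝ → ℝ≥0∞}
    (hG : ∀ i, Measurable (G i)) (n : ℕ) :
    (∫⁻ t, (K * ∑ i ∈ Finset.range n, G i t) ^ p) ^ (1 / p) ≤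
      K * ∑ i ∈ Finset.range n, (∫⁻ t, G i t ^ p) ^ (1 / p) := by
  have hp0 : 0 < p := by linarith
  have hsum : (∫⁻ t, (∑ i ∈ Finset.range n, G i t) ^ p) ^ (1 / p) ≤
      ∑ i ∈ Finset.range n, (∫⁻ t, G i t ^ p) ^ (1 / p) := by
    induction n with
    | zero => simp [hp0]
    | succ n ih =>
      simp only [Finset.sum_range_succ]
      exact (ENNReal.lintegral_Lp_add_le (f := fun t => ∑ i ∈ Finset.range n, G i t)
        (Finset.measurable_sum _ fun i _ => hG i).aemeasurable (hG n).aemeasurable hp).trans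
        (by gcongr)
  simp only [ENNReal.mul_rpow_of_nonneg _ _ hp0.le]
  rw [lintegral_const_mul' _ _ (ENNReal.rpow_ne_top_of_nonneg hp0.le ENNReal.coe_ne_top),
    ENNReal.mul_rpow_of_nonneg _ _ (by positivity), ← ENNReal.rpow_mul, mul_one_div_cancel hp0.ne',
    ENNReal.rpow_one]
  gcongr

/-- The `L^p` error of the sampling operator is bounded by averaged moduli of smoothness. -/
theorem exists_eLpNorm_samplingOp_sub_le : ∃ K : ℝ≥0, ∀ f : ℝ → ℂ,
    (∀ i < 2, Differentiable ℝ (iteratedDeriv i f)) → ∀ p : ℝ, 1 ≤ p → ∀ W : ℝ, 1 ≤ W →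
      eLpNorm (fun t => samplingOp (bspline 4) 0 3 W f t - f t) (ENNReal.ofReal p) volume ≤
        K * ∑ i ∈ Finset.range 3, tauModulus 3 (iteratedDeriv i f) (6 / W) p := by
  obtain ⟨K, hK⟩ := exists_enorm_samplingOp_sub_le
  refine ⟨K, fun f hf p hp W hW => ?_⟩
  have hp0 : 0 < p := by linarith
  have hW0 : 0 < W := by linarith
  have hl : Measurable fun t : ℝ => ⌊W * t / 3⌋ := by fun_prop
  -- Centred at the cell, the modulus depends on `t` only through an integer, so it is measurable
  -- for arbitrary `f`. Minkowski's inequality is applied at this stage; the later passage to moduli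
  -- centred at `t` needs only monotonicity.
  have hG : ∀ i : ℕ, Measurable fun t : ℝ =>
      localModulus 3 (iteratedDeriv i f) ((3 * ⌊W * t / 3⌋ + 3) / W) (4 / W) := fun i =>
    (Measurable.of_discrete (f := fun l : ℤ =>
      localModulus 3 (iteratedDeriv i f) ((3 * l + 3) / W) (4 / W))).comp hl
  rw [eLpNorm_eq_lintegral_rpow_enorm_toReal (by simpa using hp0) ENNReal.ofReal_ne_top,
    ENNReal.toReal_ofReal hp0.le]
  calc (∫⁻ t, ‖samplingOp (bspline 4) 0 3 W f t - f t‖ₑ ^ p) ^ (1 / p)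
      ≤ (∫⁻ t, (K * ∑ i ∈ Finset.range 3, localModulus 3 (iteratedDeriv i f)
          ((3 * ⌊W * t / 3⌋ + 3) / W) (4 / W)) ^ p) ^ (1 / p) := by
        gcongr with t
        exact hK f hf W hW t
    _ ≤ K * ∑ i ∈ Finset.range 3, (∫⁻ t, localModulus 3 (iteratedDeriv i f)
          ((3 * ⌊W * t / 3⌋ + 3) / W) (4 / W) ^ p) ^ (1 / p) :=
        lintegral_rpow_const_mul_sum_le hp K hG 3
    _ ≤ K * ∑ i ∈ Finset.range 3, tauModulus 3 (iteratedDeriv i f) (6 / W) p := by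
        simp only [tauModulus]
        gcongr with i hi t
        have h0 := three_mul_floor_le (W * t)
        have h1 := le_three_mul_floor_add (W * t)
        have e : t = W * t / W := by field_simp
        -- The point `W t` lies between the node `3l` and `3l + 3`, so a window of half-length `9 =
        -- 3 · 6 / 2` around it contains `[3l - 3, 3l + 9]`; hence the scale `6 / W`.
        refine localModulus_mono ?_ ?_
        · rw [show (3 * ⌊W * t / 3⌋ + 3) / W - (3 : ℕ) * (4 / W) / 2 =
            (3 * ⌊W * t / 3⌋ - 3) / W by push_cast; ring,
            show t - (3 : ℕ) * (6 / W) / 2 = (W * t - 9) / W by push_cast; field_simp; ring]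
          gcongr ?_ / W
          linarith
        · rw [show (3 * ⌊W * t / 3⌋ + 3) / W + (3 : ℕ) * (4 / W) / 2 =
            (3 * ⌊W * t / 3⌋ + 9) / W by push_cast; ring,
            show t + (3 : ℕ) * (6 / W) / 2 = (W * t + 9) / W by push_cast; field_simp; ring]
          gcongr

end DerivSampling

/-! ### The main theorem: substituting `δ = 6 / W` in the moduli. -/

theorem mainTheorem10 :
    -- the symbol is invertible, and the sampling series converges for every `f`
    (∀ t : ℝ, IsUnit (DerivSampling.Psi (DerivSampling.bspline 4) 0 3 t).det) ∧
    (∀ (f : ℝ → ℂ) (W : ℝ), 1 ≤ W → ∀ t : ℝ,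
      Summable (DerivSampling.samplingTerm (DerivSampling.bspline 4) 0 3 W f t)) ∧
    -- reproduction of polynomials of degree at most three
    DerivSampling.ReproducesPolynomials (DerivSampling.bspline 4) 0 3 3 ∧
    -- rate of approximation
    (∀ (p α : ℝ), 1 ≤ p → 0 < α → ∀ f : ℝ → ℂ, DerivSampling.MemLambda 3 p f →
      (∀ i : ℕ, i < 3 → ∃ C : ℝ≥0, ∀ᶠ δ : ℝ in nhdsWithin 0 (Set.Ioi 0),
        DerivSampling.tauModulus 3 (iteratedDeriv i f) δ p ≤ C * ENNReal.ofReal (δ ^ α)) →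
      ∃ C : ℝ≥0, ∀ᶠ W : ℝ in atTop,
        MemLp (fun t : ℝ => DerivSampling.samplingOp (DerivSampling.bspline 4) 0 3 W f t - f t)
          (ENNReal.ofReal p) volume ∧
        eLpNorm (fun t : ℝ => DerivSampling.samplingOp (DerivSampling.bspline 4) 0 3 W f t - f t)
          (ENNReal.ofReal p) volume ≤ C * ENNReal.ofReal (W ^ (-α))) := by
  refine ⟨DerivSampling.isUnit_det_Psi_bspline_four,
    fun f W _ t => DerivSampling.summable_samplingTerm f W t,
    DerivSampling.reproducesPolynomials_bspline_four, fun p α hp hα f hf hτ => ?_⟩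
  obtain ⟨K, hK⟩ := DerivSampling.exists_eLpNorm_samplingOp_sub_le
  choose! C hC using hτ
  have hlim : Tendsto (fun W : ℝ => 6 / W) atTop (nhdsWithin 0 (Set.Ioi 0)) := by
    refine tendsto_nhdsWithin_iff.mpr ⟨tendsto_id.const_div_atTop 6, ?_⟩
    filter_upwards [eventually_gt_atTop 0] with W hW
    exact div_pos (by norm_num) hW
  refine ⟨K * ∑ i ∈ Finset.range 3, C i * (6 ^ α : ℝ).toNNReal, ?_⟩
  have hev : ∀ᶠ W : ℝ in atTop, ∀ i ∈ Finset.range 3,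
      DerivSampling.tauModulus 3 (iteratedDeriv i f) (6 / W) p ≤
        C i * ENNReal.ofReal ((6 / W) ^ α) :=
    (Finset.eventually_all _).mpr fun i hi => hlim.eventually (hC i (Finset.mem_range.mp hi))
  filter_upwards [hev, eventually_ge_atTop 1] with W hτW hW
  have hle : eLpNorm (fun t : ℝ =>
      DerivSampling.samplingOp (DerivSampling.bspline 4) 0 3 W f t - f t) (ENNReal.ofReal p) volume ≤
      ((K * ∑ i ∈ Finset.range 3, C i * (6 ^ α : ℝ).toNNReal : ℝ≥0) : ℝ≥0∞) *
        ENNReal.ofReal (W ^ (-α)) := by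
    refine (hK f (fun i hi => hf.differentiable i hi) p hp W hW).trans ?_
    have hδ : ENNReal.ofReal ((6 / W) ^ α) =
        ((6 ^ α : ℝ).toNNReal : ℝ≥0∞) * ENNReal.ofReal (W ^ (-α)) := by
      rw [Real.div_rpow (by norm_num) (by linarith), Real.rpow_neg (by linarith), div_eq_mul_inv,
        ENNReal.ofReal_mul (by positivity)]
      rfl
    push_cast
    rw [mul_assoc, Finset.sum_mul]
    gcongr with i hi
    rw [mul_assoc, ← hδ]
    exact hτW i hi
  refine ⟨⟨?_, hle.trans_lt (ENNReal.mul_lt_top ENNReal.coe_lt_top ENNReal.ofReal_lt_top)⟩, hle⟩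
  exact (DerivSampling.measurable_samplingOp_bspline_four f W).aestronglyMeasurable.sub
    hf.measurable
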